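/- Call a functor \emph{sifted-colimit-preserving} if it preserves colimits of all diagrams indexed by small sifted categories, where a category $\mathcal D$ is \emph{sifted} if it is non-empty and its diagonal functor $\mathcal D\to\mathcal D\times\mathcal D$ is final (equivalently, $\mathcal D$ is non-empty and, for all objects $A,B$ of $\mathcal D$, the category of cospans from $A$ to $B$ is connected). An object $X$ of a category $\mathcal A$ is \emph{strongly finitely presentable} if $\hom(X,-):\mathcal A\to\mathrm{Set}$ preserves sifted colimits. A category $\mathcal A$ is \emph{strongly locally finitely presentable} if it has small hom-sets (up to bijection), is cocomplete, and has a (small) set $\mathcal X$ of strongly finitely presentable objects such that every object of $\mathcal A$ is a colimit of a small sifted diagram of objects from $\mathcal X$. Let $\mathcal A$ be a strongly locally finitely presentable category, and let $\mathcal S(\mathcal A)$ be the category whose objects are the functors $\mathcal A\to\mathcal A$ preserving sifted colimits and whose morphisms are all natural transformations between them. Then $\mathcal S(\mathcal A)$ is strongly locally finitely presentable. -/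

import Mathlib

universe w v u v' u'

namespace CategoryTheory

open Limits Opposite

/-- A functor preserves sifted colimits (relative to the universe `w` of small sets) if it
preserves the colimits of all diagrams indexed by `w`-small sifted categories.
No existence of sifted colimits is presupposed. -/
class Functor.PreservesSiftedColimits {C : Type u} [Category.{v} C] {D : Type u'}
    [Category.{v'} D] (F : C ⥤ D) : Prop where
  preservesColimitsOfShape (J : Type w) [SmallCategory J] [IsSifted J] :
    PreservesColimitsOfShape J F

/-- An object `X` is strongly finitely presentable if its hom-functor `Hom(X, -)`, with values
in sets, preserves sifted colimits. -/
def isStronglyFinitelyPresentable (C : Type u) [Category.{v} C] : ObjectProperty C :=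
  fun X ↦ Functor.PreservesSiftedColimits.{w} (coyoneda.obj (op X))

/-- A category is strongly locally finitely presentable (relative to the universe `w`) if it has
small hom-sets, is cocomplete, and has a (small) set of strongly finitely presentable objects
such that every object is a sifted colimit of objects from that set. -/
class IsStronglyLocallyFinitelyPresentable (C : Type u) [Category.{v} C] : Prop
    extends LocallySmall.{w} C, HasColimitsOfSize.{w, w} C where
  exists_generator : ∃ P : ObjectProperty C, ObjectProperty.Small.{w} P ∧
    P ≤ isStronglyFinitelyPresentable.{w} C ∧
    ∀ X : C, ∃ (J : Type w) (_ : SmallCategory J) (_ : IsSifted J), P.colimitsOfShape J X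

/-- The category `S(A)` of endofunctors of `A` preserving sifted colimits; the morphisms are all
natural transformations. -/
abbrev SiftedEndofunctors (A : Type u) [Category.{v} A] : Type (max u v) :=
  ObjectProperty.FullSubcategory (fun F : A ⥤ A ↦ F.PreservesSiftedColimits.{w})

end CategoryTheory

/-! The generators of `SiftedEndofunctors A` are the copowers `Hom(c, -) • x`, with `c` and `x` in a
generating set of strongly finitely presentable objects. By Yoneda, maps from such a functor to `G`
are maps `x ⟶ G c`. Colimits of endofunctors preserving sifted colimits are pointwise, so these
copowers are strongly finitely presentable; they detect isomorphisms because a natural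
transformation is invertible once it is so on generators. It remains to pass from "jointly
conservative" to "every object is a sifted colimit": close the set under finite coproducts, so that
the comma category over any object is sifted, and check that its canonical colimit is that object.
-/

namespace CategoryTheory

open Limits Opposite MonoidalCategory

/-! ### Sifted colimits commute with finite products in `Type` -/

section SiftedTypes

variable {C : Type u} [Category.{v} C]

/-- The pointwise product of two `Type`-valued functors preserving the colimit of all diagrams
indexed by a sifted category `J` preserves them too. -/
lemma preservesColimitsOfShape_tensor_of_isSifted {J : Type u'} [Category.{v'} J] [IsSifted J]
    (F G : C ⥤ Type w) [PreservesColimitsOfShape J F] [PreservesColimitsOfShape J G] :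
    PreservesColimitsOfShape J (F ⊗ G) where
  preservesColimit {K} :=
    { preserves := fun {c} hc ↦ by
        have (X : Type w) : PreservesColimit (K ⋙ G) ((curriedTensor (Type w)).obj X) :=
          inferInstanceAs (PreservesColimit (K ⋙ G) (tensorLeft X))
        have (X : Type w) : PreservesColimit (K ⋙ F) ((curriedTensor (Type w)).flip.obj X) :=
          preservesColimit_of_natIso _ (BraidedCategory.tensorLeftIsoTensorRight X)
        -- Products of sets preserve colimits in each variable, which gives a colimit over `J × J`;
        -- finality of the diagonal restricts it to `J`.
        have h := isColimitOfPreserves₂ (curriedTensor (Type w)) (isColimitOfPreserves F hc)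
          (isColimitOfPreserves G hc)
        refine ⟨IsColimit.ofIsoColimit ((Functor.Final.isColimitWhiskerEquiv
          (Functor.diag J) _).symm h) ?_⟩
        exact Cocone.ext (Iso.refl _) (fun j ↦ by ext; rfl) }

/-- A `Type`-valued functor with singleton values preserves connected colimits. -/
lemma preservesColimitsOfShape_of_unique {J : Type u'} [Category.{v'} J] [IsConnected J]
    (F : C ⥤ Type w) [∀ X, Unique (F.obj X)] : PreservesColimitsOfShape J F where
  preservesColimit {K} :=
    { preserves := fun {c} hc ↦ by
        have (s : Cocone (K ⋙ F)) (j j' : J) :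
            s.ι.app j (default : F.obj (K.obj j)) = s.ι.app j' (default : F.obj (K.obj j')) :=
          constant_of_preserves_morphisms (fun j ↦ s.ι.app j (default : F.obj (K.obj j)))
            (fun j₁ j₂ f ↦ by
              rw [← s.w f]
              exact congrArg (s.ι.app j₂) (Subsingleton.elim (α := F.obj (K.obj j₂)) _ _)) j j'
        let j₀ : J := Classical.arbitrary J
        exact ⟨{
          desc s := ↾fun _ ↦ s.ι.app j₀ (default : F.obj (K.obj j₀))
          fac s j := by
            ext x
            obtain rfl := Subsingleton.elim (α := F.obj (K.obj j)) default x
            exact this s j₀ j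
          uniq s m hm := by
            ext x
            obtain rfl := Subsingleton.elim (α := F.obj c.pt)
              (F.map (c.ι.app j₀) (default : F.obj (K.obj j₀))) x
            exact ConcreteCategory.congr_hom (hm j₀) (default : F.obj (K.obj j₀)) }⟩ }

end SiftedTypes

/-! ### A recognition criterion -/

section StronglyFinitelyPresentable

variable {C : Type u} [Category.{v} C]

lemma Functor.PreservesSiftedColimits.of_natIso {D : Type u'} [Category.{v'} D] {F G : C ⥤ D}
    (e : F ≅ G) (hF : F.PreservesSiftedColimits.{w}) : G.PreservesSiftedColimits.{w} where
  preservesColimitsOfShape J _ _ := by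
    have := hF.preservesColimitsOfShape J
    exact preservesColimitsOfShape_of_natIso e

/-- Functors preserving sifted colimits preserve colimits indexed by essentially small sifted
categories. -/
lemma Functor.PreservesSiftedColimits.preservesColimitsOfShape_of_essentiallySmall
    {D : Type u'} [Category.{v'} D] {F : C ⥤ D} (hF : F.PreservesSiftedColimits.{w})
    (J : Type*) [Category* J] [EssentiallySmall.{w} J] [IsSifted J] :
    PreservesColimitsOfShape J F := by
  have := IsSifted.isSifted_of_equiv (equivSmallModel.{w} J).symm
  have := hF.preservesColimitsOfShape (SmallModel.{w} J)
  exact preservesColimitsOfShape_of_equiv (equivSmallModel.{w} J).symm F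

/-- `Hom(X₁ ⨿ X₂, -)` is the product of `Hom(X₁, -)` and `Hom(X₂, -)`. -/
instance : (isStronglyFinitelyPresentable.{w} C).IsClosedUnderBinaryCoproducts where
  colimitsOfShape_le := by
    rintro X ⟨p⟩
    let f₁ := p.ι.app ⟨.left⟩
    let f₂ := p.ι.app ⟨.right⟩
    let e : coyoneda.obj (op (p.diag.obj ⟨.left⟩)) ⊗ coyoneda.obj (op (p.diag.obj ⟨.right⟩)) ≅
        coyoneda.obj (op X) := Iso.symm <|
      NatIso.ofComponents (fun Y ↦ (Equiv.ofBijective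
        (fun g : X ⟶ Y ↦ ((f₁ ≫ g, f₂ ≫ g) : (_ ⟶ Y) × (_ ⟶ Y)))
        ⟨fun g g' h ↦ p.isColimit.hom_ext (by
            rintro ⟨_ | _⟩
            exacts [congrArg _root_.Prod.fst h, congrArg _root_.Prod.snd h]),
          fun ⟨g₁, g₂⟩ ↦ ⟨p.isColimit.desc ⟨Y, mapPair g₁ g₂⟩, Prod.ext
            (p.isColimit.fac _ ⟨.left⟩) (p.isColimit.fac _ ⟨.right⟩)⟩⟩).toIso)
        (fun {Y Z} h ↦ by
          ext g
          exact Prod.ext (Category.assoc f₁ g h).symm (Category.assoc f₂ g h).symm)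
    refine Functor.PreservesSiftedColimits.of_natIso e ⟨fun J _ _ ↦ ?_⟩
    have := (p.prop_diag_obj ⟨.left⟩).preservesColimitsOfShape J
    have := (p.prop_diag_obj ⟨.right⟩).preservesColimitsOfShape J
    exact preservesColimitsOfShape_tensor_of_isSifted _ _

instance : (isStronglyFinitelyPresentable.{w} C).IsClosedUnderColimitsOfShape
    (Discrete.{0} PEmpty) where
  colimitsOfShape_le := by
    rintro X ⟨p⟩
    have (Y : C) : Unique ((coyoneda.obj (op X)).obj Y) :=
      { default := p.isColimit.desc ⟨Y, { app := by rintro ⟨⟨⟩⟩, naturality := by rintro ⟨⟨⟩⟩ }⟩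
        uniq _ := p.isColimit.hom_ext (by rintro ⟨⟨⟩⟩) }
    exact ⟨fun J _ _ ↦ preservesColimitsOfShape_of_unique _⟩

/-- In a cocomplete category, a small set of strongly finitely presentable objects whose
hom-functors jointly reflect isomorphisms exhibits the category as strongly locally finitely
presentable. -/
theorem IsStronglyLocallyFinitelyPresentable.of_jointly_conservative
    [LocallySmall.{w} C] [HasColimitsOfSize.{w, w} C]
    (P : ObjectProperty C) [ObjectProperty.EssentiallySmall.{w} P]
    (hP : P ≤ isStronglyFinitelyPresentable.{w} C)
    (hP' : ∀ ⦃X Y : C⦄ (f : X ⟶ Y),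
      (∀ G, P G → Function.Bijective (fun g : G ⟶ X ↦ g ≫ f)) → IsIso f) :
    IsStronglyLocallyFinitelyPresentable.{w} C where
  exists_generator := by
    have : HasFiniteColimits C := hasFiniteColimits_of_hasColimitsOfSize C
    have : (isStronglyFinitelyPresentable.{w} C).IsClosedUnderFiniteCoproducts := .mk'
    have : (isStronglyFinitelyPresentable.{w} C).IsClosedUnderIsomorphisms :=
      ObjectProperty.IsClosedUnderBinaryCoproducts.closedUnderIsomorphisms _
    let Q := P.colimitsClosure (fun n : ℕ ↦ Discrete (Fin n))
    have hQ : Q ≤ isStronglyFinitelyPresentable.{w} C := ObjectProperty.colimitsClosure_le hP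
    have (n : ℕ) : Q.IsClosedUnderColimitsOfShape (Discrete (Fin n)) :=
      inferInstanceAs ((P.colimitsClosure (fun n : ℕ ↦ Discrete (Fin n))
        ).IsClosedUnderColimitsOfShape ((fun n : ℕ ↦ Discrete (Fin n)) n))
    have : Q.IsClosedUnderFiniteCoproducts := ⟨fun J _ ↦ by
      obtain ⟨n, ⟨e⟩⟩ := Finite.exists_equiv_fin J
      exact .of_equivalence (Discrete.equivalence e.symm)⟩
    have : ObjectProperty.EssentiallySmall.{w} Q := by dsimp only [Q]; infer_instance
    obtain ⟨R, _, hRQ, hQR⟩ := ObjectProperty.EssentiallySmall.exists_small_le.{w} Q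
    refine ⟨R, inferInstance, hRQ.trans hQ, fun X ↦ ?_⟩
    let K := CostructuredArrow Q.ι X
    -- `K` inherits finite coproducts from `Q`, hence is sifted.
    have : Nonempty K := ⟨⊥_ K⟩
    have hK : IsSifted K := inferInstance
    let e := equivSmallModel.{w} K
    have : HasColimitsOfShape K C := hasColimitsOfShape_of_equivalence e.symm
    let D : K ⥤ C := CostructuredArrow.proj Q.ι X ⋙ Q.ι
    let c : Cocone D :=
      { pt := X
        ι :=
          { app k := k.hom
            naturality k k' f :=
              (CostructuredArrow.w f).trans (Category.comp_id k.hom).symm } }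
    have : IsIso (colimit.desc D c) := hP' _ (fun G hG ↦ by
      refine ⟨fun g₁ g₂ h ↦ ?_, fun g ↦ ?_⟩
      · have hG' := (hP _ hG).preservesColimitsOfShape_of_essentiallySmall K
        have hcol := isColimitOfPreserves (coyoneda.obj (op G)) (colimit.isColimit D)
        let k : K := CostructuredArrow.mk (S := Q.ι)
          (Y := ⟨G, P.le_colimitsClosure _ _ hG⟩) (by exact g₁ ≫ colimit.desc D c)
        -- `g` factors through some stage `j` as `φ`, and `φ` is itself a morphism `k ⟶ j` of `K`;
        -- so `g` is the coprojection at `k`, which depends only on the composite to `X`.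
        have key (g : G ⟶ colimit D)
            (hg : g ≫ colimit.desc D c = g₁ ≫ colimit.desc D c) : g = colimit.ι D k := by
          obtain ⟨j, φ, hφ⟩ := Types.jointly_surjective_of_isColimit hcol g
          obtain rfl : φ ≫ colimit.ι D j = g := hφ
          have hφ' : φ ≫ j.hom = g₁ ≫ colimit.desc D c := by rw [← hg]; simp [c]
          let ψ : k ⟶ j := CostructuredArrow.homMk (ObjectProperty.homMk φ) hφ'
          exact colimit.w D ψ
        exact (key g₁ rfl).trans (key g₂ h.symm).symm
      · let k : K := CostructuredArrow.mk (S := Q.ι)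
          (Y := ⟨G, P.le_colimitsClosure _ _ hG⟩) (by exact g)
        exact ⟨colimit.ι D k, colimit.ι_desc c k⟩)
    refine ⟨SmallModel.{w} K, inferInstance, IsSifted.isSifted_of_equiv e.symm, ?_⟩
    rw [← ObjectProperty.colimitsOfShape_isoClosure]
    exact ⟨{ diag := _
             ι := _
             isColimit := ((colimit.isColimit D).ofIsoColimit
                (Cocone.ext (asIso (colimit.desc D c)) : _ ≅ c)).whiskerEquivalence e.symm
             prop_diag_obj j := hQR _ (e.inverse.obj j).left.property }⟩

end StronglyFinitelyPresentable

/-! ### Pointwise colimits of functors preserving colimits -/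

section FunctorCategory

variable {C : Type u} [Category.{v} C] {D : Type u'} [Category.{v'} D]

/-- Colimits commute with colimits: `G` is the flipped diagram followed by `colim`, a left adjoint.
-/
instance (K K' : Type*) [Category* K] [Category* K'] [HasColimitsOfShape K' D] :
    (ObjectProperty.preservesColimitsOfShape K :
      ObjectProperty (C ⥤ D)).IsClosedUnderColimitsOfShape K' where
  colimitsOfShape_le := by
    rintro G ⟨h⟩
    have := h.prop_diag_obj
    have : PreservesColimitsOfShape K h.diag.flip := ⟨fun {F} ↦ ⟨fun {c} hc ↦
      ⟨evaluationJointlyReflectsColimits _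
        (fun k' ↦ isColimitOfPreserves (h.diag.obj k') hc)⟩⟩⟩
    let e : h.diag.flip ⋙ colim ≅ G :=
      NatIso.ofComponents
        (fun j ↦ (colimit.isColimit (h.diag.flip.obj j)).coconePointUniqueUpToIso
          (isColimitOfPreserves ((evaluation _ _).obj j) h.isColimit))
        (fun f ↦ colimit.hom_ext (fun j ↦ by
          have h₁ (X : C) := (colimit.isColimit (h.diag.flip.obj X)).comp_coconePointUniqueUpToIso_hom
            (isColimitOfPreserves ((evaluation _ _).obj X) h.isColimit) j
          dsimp at h₁ ⊢
          simp [h₁, reassoc_of% h₁]))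
    exact preservesColimitsOfShape_of_natIso e

instance (K' : Type*) [Category* K'] [HasColimitsOfShape K' D] :
    ObjectProperty.IsClosedUnderColimitsOfShape
      (fun F : C ⥤ D ↦ F.PreservesSiftedColimits.{w}) K' where
  colimitsOfShape_le := by
    rintro G ⟨h⟩
    exact ⟨fun J _ _ ↦ (ObjectProperty.preservesColimitsOfShape J).prop_of_isColimit h.isColimit
      (fun k ↦ (h.prop_diag_obj k).preservesColimitsOfShape J)⟩

end FunctorCategory

/-! ### Change of universe for hom-functors -/

section Shrink

universe w'

variable {C : Type u} [Category.{v} C]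

instance preservesColimitsOfShape_shrink {J : Type u'} [Category.{v'} J] (F : C ⥤ Type w')
    [FunctorToTypes.Small.{w} F] [PreservesColimitsOfShape J F] :
    PreservesColimitsOfShape J (FunctorToTypes.shrink.{w} F) := by
  have : PreservesColimitsOfShape J (F ⋙ uliftFunctor.{w}) := inferInstance
  have : PreservesColimitsOfShape J (FunctorToTypes.shrink.{w} F ⋙ uliftFunctor.{w'}) :=
    preservesColimitsOfShape_of_natIso
      (NatIso.ofComponents (fun X ↦ (Equiv.ulift.trans ((equivShrink.{w} (F.obj X)).trans
        Equiv.ulift.symm)).toIso) (fun {X Y} f ↦ by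
          ext x
          exact ULift.ext _ _ (congrArg (fun y ↦ equivShrink.{w} (F.obj Y) (F.map f y))
            ((equivShrink.{w} (F.obj X)).symm_apply_apply x.down).symm)) :
        F ⋙ uliftFunctor.{w} ≅ FunctorToTypes.shrink.{w} F ⋙ uliftFunctor.{w'})
  exact preservesColimitsOfShape_of_reflects_of_preserves _ uliftFunctor.{w'}

end Shrink

/-! ### Copowers of hom-functors and their Yoneda lemma -/

section Copower

variable {A : Type u} [Category.{v} A] [LocallySmall.{w} A]

instance (c : A) : FunctorToTypes.Small.{w} (coyoneda.obj (op c)) :=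
  fun Y ↦ inferInstanceAs (Small.{w} (c ⟶ Y))

variable [HasColimitsOfSize.{w, w} A]

/-- In a locally small category, taking copowers of `x` is left adjoint to the shrunk
functor `Hom(x, -)`. -/
noncomputable def sigmaConstAdjShrink (x : A) :
    sigmaConst.{w}.obj x ⊣ FunctorToTypes.shrink.{w} (coyoneda.obj (op x)) :=
  Adjunction.mkOfHomEquiv
    { homEquiv S Y :=
        { toFun f := ↾fun s ↦ equivShrink.{w} (x ⟶ Y) (Sigma.ι (fun _ : S ↦ x) s ≫ f)
          invFun g := Limits.Sigma.desc (fun s : S ↦ (equivShrink.{w} (x ⟶ Y)).symm (g s))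
          left_inv f := by
            refine Sigma.hom_ext _ _ (fun s ↦ ?_)
            rw [Sigma.ι_desc]
            exact (equivShrink.{w} (x ⟶ Y)).symm_apply_apply _
          right_inv g := by
            ext s
            refine (congrArg (equivShrink.{w} (x ⟶ Y)) (Sigma.ι_desc _ _)).trans ?_
            exact (equivShrink.{w} (x ⟶ Y)).apply_symm_apply _ }
      homEquiv_naturality_left_symm {S S' Y} f g := by
        refine Sigma.hom_ext _ _ (fun s ↦ ?_)
        simp
      homEquiv_naturality_right {S Y Y'} f g := by
        ext s
        refine congrArg (equivShrink.{w} (x ⟶ Y')) ((Category.assoc _ _ _).symm.trans ?_)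
        exact congrArg (· ≫ g) ((equivShrink.{w} (x ⟶ Y)).symm_apply_apply _).symm }

/-- The functor sending `Y` to the copower of `x` indexed by `Hom(c, Y)`. -/
noncomputable def copowerCoyoneda (c x : A) : A ⥤ A :=
  FunctorToTypes.shrink.{w} (coyoneda.obj (op c)) ⋙ sigmaConst.{w}.obj x

lemma preservesSiftedColimits_copowerCoyoneda {c : A}
    (hc : isStronglyFinitelyPresentable.{w} A c) (x : A) :
    (copowerCoyoneda.{w} c x).PreservesSiftedColimits.{w} where
  preservesColimitsOfShape J _ _ := by
    have := hc.preservesColimitsOfShape J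
    have := (sigmaConstAdjShrink.{w} x).leftAdjoint_preservesColimits
    dsimp only [copowerCoyoneda]
    infer_instance

/-- The canonical map from `x` to the copower of `x` indexed by `Hom(c, Y)`, for `f : c ⟶ Y`. -/
noncomputable def ιCopowerCoyoneda (c x : A) {Y : A} (f : c ⟶ Y) :
    x ⟶ (copowerCoyoneda.{w} c x).obj Y :=
  Sigma.ι (fun _ : Shrink.{w} (c ⟶ Y) ↦ x) (equivShrink.{w} (c ⟶ Y) f)

lemma copowerCoyoneda_hom_ext {c x Y Z : A} {g g' : (copowerCoyoneda.{w} c x).obj Y ⟶ Z}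
    (h : ∀ f : c ⟶ Y, ιCopowerCoyoneda.{w} c x f ≫ g = ιCopowerCoyoneda.{w} c x f ≫ g') :
    g = g' :=
  Sigma.hom_ext _ _ (fun s ↦ by
    obtain ⟨f, rfl⟩ := (equivShrink.{w} (c ⟶ Y)).surjective s
    exact h f)

lemma ιCopowerCoyoneda_map (c x : A) {Y Z : A} (f : c ⟶ Y) (g : Y ⟶ Z) :
    ιCopowerCoyoneda.{w} c x f ≫ (copowerCoyoneda.{w} c x).map g =
      ιCopowerCoyoneda.{w} c x (f ≫ g) := by
  refine (Sigma.ι_comp_map' _ _ _).trans ((Category.id_comp _).trans ?_)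
  exact congrArg (Sigma.ι (fun _ : Shrink.{w} (c ⟶ Z) ↦ x))
    (congrArg (fun f ↦ equivShrink.{w} (c ⟶ Z) (f ≫ g))
      ((equivShrink.{w} (c ⟶ Y)).symm_apply_apply f))

/-- A family of morphisms `x ⟶ Z` indexed by `Hom(c, Y)` induces a morphism from the copower. -/
noncomputable def copowerCoyonedaDesc {c x Y Z : A} (φ : (c ⟶ Y) → (x ⟶ Z)) :
    (copowerCoyoneda.{w} c x).obj Y ⟶ Z :=
  Limits.Sigma.desc (fun s : Shrink.{w} (c ⟶ Y) ↦ φ ((equivShrink.{w} (c ⟶ Y)).symm s))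

@[simp]
lemma ιCopowerCoyoneda_desc {c x Y Z : A} (φ : (c ⟶ Y) → (x ⟶ Z)) (f : c ⟶ Y) :
    ιCopowerCoyoneda.{w} c x f ≫ copowerCoyonedaDesc.{w} φ = φ f :=
  (Sigma.ι_desc _ _).trans (congrArg φ ((equivShrink.{w} (c ⟶ Y)).symm_apply_apply f))

/-- Yoneda-type bijection: natural transformations from `copowerCoyoneda c x` to `G` are the
morphisms `x ⟶ G.obj c`. -/
noncomputable def copowerCoyonedaHomEquiv (c x : A) (G : A ⥤ A) :
    (copowerCoyoneda.{w} c x ⟶ G) ≃ (x ⟶ G.obj c) where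
  toFun α := ιCopowerCoyoneda.{w} c x (𝟙 c) ≫ α.app c
  invFun g :=
    { app Y := copowerCoyonedaDesc.{w} (fun f ↦ g ≫ G.map f)
      naturality Y Z h := copowerCoyoneda_hom_ext (fun f ↦ by
        rw [← Category.assoc, ιCopowerCoyoneda_map, ← Category.assoc]
        simp) }
  left_inv α := by
    ext Y
    refine copowerCoyoneda_hom_ext (fun f ↦ ?_)
    rw [ιCopowerCoyoneda_desc, Category.assoc, ← α.naturality, ← Category.assoc,
      ιCopowerCoyoneda_map, Category.id_comp]
  right_inv g := by simp

end Copower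

/-! ### Generators of the endofunctor category -/

section SiftedEndofunctors

variable {A : Type u} [Category.{v} A]

variable [LocallySmall.{w} A] [HasColimitsOfSize.{w, w} A]

/-- The functor it corepresents is evaluation at `c` followed by `Hom(x, -)`, up to a universe lift;
both preserve sifted colimits. -/
lemma isStronglyFinitelyPresentable_copowerCoyoneda {c x : A}
    (hc : isStronglyFinitelyPresentable.{w} A c) (hx : isStronglyFinitelyPresentable.{w} A x) :
    isStronglyFinitelyPresentable.{w} (SiftedEndofunctors.{w} A)
      ⟨copowerCoyoneda.{w} c x, preservesSiftedColimits_copowerCoyoneda hc x⟩ := by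
  let P : ObjectProperty (A ⥤ A) := fun F ↦ F.PreservesSiftedColimits.{w}
  let e : (P.ι ⋙ (evaluation A A).obj c ⋙ coyoneda.obj (op x)) ⋙ uliftFunctor.{u} ≅
      coyoneda.obj (op (⟨copowerCoyoneda.{w} c x,
        preservesSiftedColimits_copowerCoyoneda hc x⟩ : SiftedEndofunctors.{w} A)) := Iso.symm <|
    NatIso.ofComponents (fun G ↦ ((P.fullyFaithfulι.homEquiv (X := ⟨copowerCoyoneda.{w} c x,
        preservesSiftedColimits_copowerCoyoneda hc x⟩) (Y := G)).trans
      ((copowerCoyonedaHomEquiv.{w} c x G.obj).trans Equiv.ulift.symm)).toIso)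
      (fun {G H} α ↦ by
        ext β
        exact ULift.ext _ _ (Category.assoc (ιCopowerCoyoneda.{w} c x (𝟙 c))
          (β.hom.app c) (α.hom.app c)).symm)
  refine Functor.PreservesSiftedColimits.of_natIso e ⟨fun J _ _ ↦ ?_⟩
  have := hx.preservesColimitsOfShape J
  infer_instance

lemma Functor.PreservesSiftedColimits.isIso_of_isIso_app {C : Type u} [Category.{v} C]
    {D : Type u'} [Category.{v'} D] {P : ObjectProperty C}
    (hP : ∀ X : C, ∃ (J : Type w) (_ : SmallCategory J) (_ : IsSifted J), P.colimitsOfShape J X)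
    {F G : C ⥤ D} (hF : F.PreservesSiftedColimits.{w}) (hG : G.PreservesSiftedColimits.{w})
    (α : F ⟶ G) (hα : ∀ X, P X → IsIso (α.app X)) : IsIso α := by
  rw [NatTrans.isIso_iff_isIso_app]
  intro X
  obtain ⟨J, _, _, ⟨p⟩⟩ := hP X
  have := hF.preservesColimitsOfShape J
  have := hG.preservesColimitsOfShape J
  have (j : J) : IsIso (α.app (p.diag.obj j)) := hα _ (p.prop_diag_obj j)
  let e : p.diag ⋙ F ≅ p.diag ⋙ G := NatIso.ofComponents (fun j ↦ asIso (α.app (p.diag.obj j)))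
  let i := (isColimitOfPreserves F p.isColimit).coconePointsIsoOfNatIso
    (isColimitOfPreserves G p.isColimit) e
  have : α.app X = i.hom := (isColimitOfPreserves F p.isColimit).hom_ext (fun j ↦ by
    rw [IsColimit.comp_coconePointsIsoOfNatIso_hom]
    exact α.naturality _)
  rw [this]
  infer_instance

lemma Functor.PreservesSiftedColimits.natTrans_ext {C : Type u} [Category.{v} C]
    {D : Type u'} [Category.{v'} D] {P : ObjectProperty C}
    (hP : ∀ X : C, ∃ (J : Type w) (_ : SmallCategory J) (_ : IsSifted J), P.colimitsOfShape J X)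
    {F G : C ⥤ D} (hF : F.PreservesSiftedColimits.{w}) {α β : F ⟶ G}
    (h : ∀ X, P X → α.app X = β.app X) : α = β := by
  ext X
  obtain ⟨J, _, _, ⟨p⟩⟩ := hP X
  have := hF.preservesColimitsOfShape J
  refine (isColimitOfPreserves F p.isColimit).hom_ext (fun j ↦ ?_)
  exact (α.naturality _).trans ((congrArg (· ≫ _) (h _ (p.prop_diag_obj j))).trans
    (β.naturality _).symm)

end SiftedEndofunctors

end CategoryTheory

theorem mainTheorem8 {A : Type u} [CategoryTheory.Category.{v} A]
    (hA : CategoryTheory.IsStronglyLocallyFinitelyPresentable.{w} A) :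
    CategoryTheory.IsStronglyLocallyFinitelyPresentable.{w}
      (CategoryTheory.SiftedEndofunctors.{w} A) := by
  open CategoryTheory Limits in
  obtain ⟨P, _, hP, hP'⟩ := hA.exists_generator
  have hgen := ObjectProperty.IsStrongGenerator.mk_of_exists_colimitsOfShape.{w}
    (fun X ↦ by
      obtain ⟨J, _, _, h⟩ := hP' X
      exact ⟨J, inferInstance, h⟩)
  -- A transformation is determined by its components on the small set `P`.
  have : LocallySmall.{w} (SiftedEndofunctors.{w} A) :=
    ⟨fun F G ↦ small_of_injective
      (f := fun (α : F ⟶ G) (X : Subtype P) ↦ α.hom.app X.1)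
      (fun α β h ↦ by
        ext1
        exact F.property.natTrans_ext hP' (fun X hX ↦ congrFun h ⟨X, hX⟩))⟩
  have : HasColimitsOfSize.{w, w} (SiftedEndofunctors.{w} A) := ⟨fun J _ ↦ inferInstance⟩
  let Φ (i : Subtype P × Subtype P) : SiftedEndofunctors.{w} A :=
    ⟨copowerCoyoneda.{w} i.1.1 i.2.1, preservesSiftedColimits_copowerCoyoneda (hP _ i.1.2) _⟩
  refine .of_jointly_conservative (ObjectProperty.ofObj Φ) ?_ (fun F G α hα ↦ ?_)
  · rintro _ ⟨i⟩
    exact isStronglyFinitelyPresentable_copowerCoyoneda (hP _ i.1.2) (hP _ i.2.2)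
  · have hc (c : A) (hc : P c) : IsIso (α.hom.app c) := by
      have hb (x : A) (hx : P x) :
          Function.Bijective (fun g : x ⟶ F.obj.obj c ↦ g ≫ α.hom.app c) := by
        let e (H : SiftedEndofunctors.{w} A) : (Φ (⟨c, hc⟩, ⟨x, hx⟩) ⟶ H) ≃ (x ⟶ H.obj.obj c) :=
          (ObjectProperty.fullyFaithfulι _).homEquiv.trans (copowerCoyonedaHomEquiv.{w} c x H.obj)
        have he (β : Φ (⟨c, hc⟩, ⟨x, hx⟩) ⟶ F) : e G (β ≫ α) = e F β ≫ α.hom.app c :=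
          (Category.assoc (ιCopowerCoyoneda.{w} c x (𝟙 c)) (β.hom.app c) (α.hom.app c)).symm
        have := hα _ ⟨(⟨c, hc⟩, ⟨x, hx⟩)⟩
        -- The Yoneda bijections turn composition with `α` into composition with its component at
        -- `c`.
        rw [← (e F).bijective.of_comp_iff]
        exact (funext he : _ = (fun g ↦ g ≫ α.hom.app c) ∘ e F) ▸ (e G).bijective.comp this
      -- Injectivity gives a monomorphism since `P` separates; surjectivity then gives an
      -- isomorphism since `P` is a strong generator.
      have : Mono (α.hom.app c) := by
        rw [hgen.isSeparating.mono_iff]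
        exact fun x hx g g' h ↦ (hb x hx).1 h
      exact hgen.isIso_of_mono _ (fun x hx ↦ (hb x hx).2)
    have := F.property.isIso_of_isIso_app hP' G.property α.hom hc
    exact @Functor.FullyFaithful.isIso_of_isIso_map _ _ _ _ _
      (ObjectProperty.fullyFaithfulι _) _ _ α this
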